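/- Let $n$ be a positive integer. For $i,k,i',k'\in\{0,\dots,n-1\}$ put $$\Delta(a_ib_k,a_{i'}b_{k'})=\chi(i\ge i')-\chi(i=k=i')+\chi(k\le k')-\chi(k=i'=k'),$$ where $\chi(A)=1$ if $A$ holds and $\chi(A)=0$ otherwise. Let $\mathcal P_n$ be the set of partitions $\lambda_1+\cdots+\lambda_s$ into positive parts (the empty partition included), each part $\lambda_j$ having a colour $c(\lambda_j)\in\{a_ib_k:0\le i,k\le n-1\}$, such that $\lambda_j-\lambda_{j+1}\ge\Delta(c(\lambda_j),c(\lambda_{j+1}))$ for $1\le j\le s-1$. Let $P_n(m;u_0,\dots,u_{n-1};v_0,\dots,v_{n-1})$ be the number of partitions of $m$ in $\mathcal P_n$ such that, for each $i\in\{0,\dots,n-1\}$, the symbol $a_i$ appears $u_i$ times and the symbol $b_i$ appears $v_i$ times in the colours of the parts. Then, as formal power series in $q$ (no negative exponent occurs with a non-zero coefficient, and the sum converges coefficientwise), $$\sum_{m,u_0,\dots,u_{n-1},v_0,\dots,v_{n-1}\ge0}P_n(m;u_0,\dots,u_{n-1};v_0,\dots,v_{n-1})\,q^{\,nm-\sum_{i=0}^{n-1}i(u_i-v_i)}=\frac1{(q;q)_\infty},\qquad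 (q;q)_\infty=\prod_{j\ge1}(1-q^j).$$ The cases $n=2$ and $n=3$ are Primc's two identities: (i) Under the naming $a=a_1b_0,\ b=a_0b_0,\ c=a_1b_1,\ d=a_0b_1$, the conditions $\Delta$ for $n=2$ are those of the matrix (rows and columns in the order $a,b,c,d$; the entry $(x,y)$ is the minimal difference between consecutive parts of colours $x$ and $y$) $$P_2=\begin{pmatrix}2&1&2&2\\1&0&1&1\\0&1&0&2\\0&1&0&2\end{pmatrix},$$ the weighting above is that of the dilations $k_a\to2k-1,\ k_b\to2k,\ k_c\to2k,\ k_d\to2k+1$, and if $P(m;i,j,k,\ell)$ is the number of partitions of $m$ satisfying the difference conditions $P_2$ with $i,j,k,\ell$ parts coloured $a,b,c,d$ respectively, then $\sum P(m;i,j,k,\ell)\,q^{2m-i+\ell}=1/(q;q)_\infty$. (ii) In the order $a_2b_0,a_2b_1,a_1b_0,a_0b_0,a_2b_2,a_1b_1,a_0b_1,a_1b_2,a_0b_2$ of the colours, the conditions $\Delta$ for $n=3$ are those of the matrix $$P_3=\begin{pmatrix}2&2&2&1&2&2&2&2&2\\1&2&1&1&2&1&2&2&2\\1&1&2&1&1&2&2&2&2\\1&1&1&0&1&1&1&1&1\\0&0&1&1&0&1&1&2&2\\0&1&0&1&1&0&2&1&2\\0&1&0&1&1&0&2&1&2\\0&0&1&1&0&1&1&2&2\\0&0&0&1&0&0&1&1&2\end{pmatrix},$$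 the weighting above is that of the dilations which send a part $k$ of these colours to $3k-2,\,3k-1,\,3k-1,\,3k,\,3k,\,3k,\,3k+1,\,3k+1,\,3k+2$ respectively, and under these dilations the generating function for the nine-coloured partitions satisfying the difference conditions $P_3$ is $1/(q;q)_\infty$. -/

import Mathlib

open PowerSeries
open scoped PowerSeries.WithPiTopology

/-- A partition into positive parts, listed in non-increasing order as pairs `(size, colour)`, with
colours in `C`, such that `D c c'` is the minimal difference between two consecutive parts coloured
`c` and `c'`. The empty partition is included. -/
structure ColouredPartition (C : Type) (D : C → C → ℤ) where
  parts : List (ℕ × C)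
  pos : ∀ p ∈ parts, 0 < p.1
  noninc : parts.IsChain (fun p p' => p'.1 ≤ p.1)
  diff : parts.IsChain (fun p p' => D p.2 p'.2 ≤ (p.1 : ℤ) - (p'.1 : ℤ))

namespace ColouredPartition

variable {C : Type} {D : C → C → ℤ}

/-- The weight: the sum of the parts. -/
def weight (l : ColouredPartition C D) : ℕ := (l.parts.map Prod.fst).sum

/-- The number of parts whose colour satisfies `s`. -/
def count (l : ColouredPartition C D) (s : C → Bool) : ℕ := l.parts.countP (fun p => s p.2)

/-- For a finite set of colours there are finitely many coloured partitions of each weight, so that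
the cardinalities taken below are genuine. -/
theorem finite_weight [Finite C] (m : ℕ) (P : ColouredPartition C D → Prop) :
    Finite {l : ColouredPartition C D // l.weight = m ∧ P l} := by
  have hmem : ∀ (L : List (ℕ × C)), ∀ p ∈ L, p.1 ≤ (L.map Prod.fst).sum := by
    intro L p hp
    exact List.single_le_sum (by simp) _ (List.mem_map_of_mem hp)
  have hlen : ∀ (L : List (ℕ × C)), (∀ p ∈ L, 0 < p.1) → L.length ≤ (L.map Prod.fst).sum := by
    intro L
    induction L with
    | nil => simp
    | cons a t ih =>
      intro h
      have h1 := h a (by simp)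
      have h2 := ih (fun p hp => h p (by simp [hp]))
      simp only [List.length_cons, List.map_cons, List.sum_cons]
      omega
  let T := {L : List (Fin (m + 1) × C) // L.length ≤ m}
  have hT : Finite T := (List.finite_length_le (Fin (m + 1) × C) m).to_subtype
  let f : {l : ColouredPartition C D // l.weight = m ∧ P l} → T := fun l =>
    ⟨l.1.parts.map (fun p => (Fin.ofNat (m + 1) p.1, p.2)), by
      have h := hlen l.1.parts l.1.pos
      have h2 : (l.1.parts.map Prod.fst).sum = m := l.2.1
      simpa [h2] using h⟩
  refine Finite.of_injective f ?_
  have key : ∀ l : {l : ColouredPartition C D // l.weight = m ∧ P l},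
      (f l).1.map (fun p => ((p.1 : ℕ), p.2)) = l.1.parts := by
    intro l
    have h2 : (l.1.parts.map Prod.fst).sum = m := l.2.1
    simp only [f, List.map_map]
    conv_rhs => rw [← List.map_id l.1.parts]
    refine List.map_congr_left ?_
    intro p hp
    have h3 := hmem l.1.parts p hp
    rw [h2] at h3
    simp [Fin.ofNat, Nat.mod_eq_of_lt (Nat.lt_succ_of_le h3)]
  intro l l' h
  have h4 : l.1.parts = l'.1.parts := by rw [← key l, ← key l', h]
  obtain ⟨⟨p, _, _, _⟩, _⟩ := l
  obtain ⟨⟨p', _, _, _⟩, _⟩ := l'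
  simp only at h4
  subst h4
  rfl

end ColouredPartition

/-- The minimal difference `Δ(a_i b_k, a_{i'} b_{k'})`. -/
def primcDelta (i k i' k' : ℕ) : ℤ :=
  (if i ≥ i' then 1 else 0) - (if i = k ∧ k = i' then 1 else 0)
    + (if k ≤ k' then 1 else 0) - (if k = i' ∧ i' = k' then 1 else 0)

/-- `Δ` on the `n ^ 2` colours `a_i b_k`, `0 ≤ i, k ≤ n - 1`, written as pairs `(i, k)`. -/
def primcDiff (n : ℕ) (c c' : Fin n × Fin n) : ℤ :=
  primcDelta c.1 c.2 c'.1 c'.2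

/-- `𝒫ₙ`: the generalised Primc partitions. -/
abbrev PrimcPartition (n : ℕ) : Type := ColouredPartition (Fin n × Fin n) (primcDiff n)

/-- `Pₙ(m; u; v)`: the number of generalised Primc partitions of `m` in whose colour sequence each
symbol `a_i` appears `u i` times and each symbol `b_i` appears `v i` times. -/
noncomputable def primcCount (n m : ℕ) (u v : Fin n → ℕ) : ℕ :=
  Nat.card {l : PrimcPartition n // l.weight = m ∧
    ∀ i, l.count (fun c => c.1 = i) = u i ∧ l.count (fun c => c.2 = i) = v i}

/-- The exponent `n m - ∑ i (u_i - v_i)`. -/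
def primcExponent (n m : ℕ) (u v : Fin n → ℕ) : ℤ :=
  (n : ℤ) * m - ∑ i : Fin n, (i : ℤ) * ((u i : ℤ) - (v i : ℤ))

/-- The number of coloured partitions of `m` with difference conditions `D`, having `w c` parts of
each colour `c`. -/
noncomputable def colourCount {C : Type} [DecidableEq C] (D : C → C → ℤ) (m : ℕ) (w : C → ℕ) : ℕ :=
  Nat.card {l : ColouredPartition C D // l.weight = m ∧ ∀ c, l.count (fun c' => c' = c) = w c}

/-- The exponent `N m + ∑_c s_c w_c`, which the dilations `k_c ↦ N k + s_c` give to a partition of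
`m` having `w_c` parts of each colour `c`. -/
def dilatedExponent {r : ℕ} (N : ℕ) (s : Fin r → ℤ) (m : ℕ) (w : Fin r → ℕ) : ℤ :=
  (N : ℤ) * m + ∑ c, s c * (w c : ℤ)

/-- Primc's difference matrix for the four colours `a, b, c, d`. -/
def primcMatrix4 : Fin 4 → Fin 4 → ℤ :=
  ![![2, 1, 2, 2], ![1, 0, 1, 1], ![0, 1, 0, 2], ![0, 1, 0, 2]]

/-- The names `a = a_1 b_0`, `b = a_0 b_0`, `c = a_1 b_1`, `d = a_0 b_1`. -/
def primcColour4 : Fin 4 → Fin 2 × Fin 2 := ![(1, 0), (0, 0), (1, 1), (0, 1)]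

/-- The shifts of Primc's dilations `2k - 1, 2k, 2k, 2k + 1`. -/
def primcShift4 : Fin 4 → ℤ := ![-1, 0, 0, 1]

/-- Primc's difference matrix for nine colours, in the order
`a_2b_0, a_2b_1, a_1b_0, a_0b_0, a_2b_2, a_1b_1, a_0b_1, a_1b_2, a_0b_2`. -/
def primcMatrix9 : Fin 9 → Fin 9 → ℤ :=
  ![![2, 2, 2, 1, 2, 2, 2, 2, 2],
    ![1, 2, 1, 1, 2, 1, 2, 2, 2],
    ![1, 1, 2, 1, 1, 2, 2, 2, 2],
    ![1, 1, 1, 0, 1, 1, 1, 1, 1],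
    ![0, 0, 1, 1, 0, 1, 1, 2, 2],
    ![0, 1, 0, 1, 1, 0, 2, 1, 2],
    ![0, 1, 0, 1, 1, 0, 2, 1, 2],
    ![0, 0, 1, 1, 0, 1, 1, 2, 2],
    ![0, 0, 0, 1, 0, 0, 1, 1, 2]]

/-- The names of the nine colours. -/
def primcColour9 : Fin 9 → Fin 3 × Fin 3 :=
  ![(2, 0), (2, 1), (1, 0), (0, 0), (2, 2), (1, 1), (0, 1), (1, 2), (0, 2)]

/-- The shifts of Primc's dilations
`3k - 2, 3k - 1, 3k - 1, 3k, 3k, 3k, 3k + 1, 3k + 1, 3k + 2`. -/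
def primcShift9 : Fin 9 → ℤ := ![-2, -1, -1, 0, 0, 0, 1, 1, 2]

/-- `(q; q)_∞ = ∏_{j ≥ 0} (1 - q ^ (j + 1))` as a formal power series in `q = X`; the coefficients
are compared in the discrete topology of `ℤ`. -/
noncomputable def qqInf : ℤ⟦X⟧ := ∏' j : ℕ, (1 - X ^ (j + 1) : ℤ⟦X⟧)

/-- The product defining `(q; q)_∞` converges. -/
theorem multipliable_qqInf : Multipliable fun j : ℕ => (1 - X ^ (j + 1) : ℤ⟦X⟧) := by
  simpa using PowerSeries.WithPiTopology.multipliable_one_sub_X_pow ℤ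

/-- The family of monomials `c i * q ^ e i`, in which no monomial with a non-zero coefficient has a
negative exponent, is summable, with sum `1 / (q; q)_∞`. -/
def SumsToInvQq {ι : Type} (c : ι → ℕ) (e : ι → ℤ) : Prop :=
  (∀ i, c i ≠ 0 → 0 ≤ e i) ∧
    ∃ G : ℤ⟦X⟧, G * qqInf = 1 ∧ HasSum (fun i => (c i : ℤ⟦X⟧) * X ^ (e i).toNat) G

/-! The exponent is the sum of the dilated parts: a part `K` coloured `a_i b_k` becomes `nK - i +
k`. The proof shows that the generating function of this weight does not depend on `n`, by counting
one auxiliary set in two ways, and then reads it off at `n = 1`.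

The auxiliary set consists of the partitions `z_0 ≥ z_1 ≥ ...` in which only multiples of `n` may be
repeated, weighted by `z_0 + z_2 + z_4 + ...`. Given a Primc partition with parts `(K_j, i_j, k_j)`
and an ordinary partition `x`, put `z_{2j} = n(K_j + x_j) - i_j + k_j` and `z_{2j+1} = n(K_{j+1} +
δ_j + x_j) - i_{j+1} + k_j`, where `δ_j` is the `b`-half of `Δ`. The step from `z_{2j}` to
`z_{2j+1}` is admissible exactly when the difference condition `Δ` holds, and the step from
`z_{2j+1}` to `z_{2j+2}` exactly when `x_{j+1} ≤ x_j`. Residues mod `n` recover the colours, so this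
is a bijection (`bijective_interleaveSeq`), and the weight of `z` is the dilated weight plus `n|x|`.

On the other hand, `z` is uniquely a set of distinct parts together with pairs of equal multiples of
`n`; a pair `nx, nx` adds `nx` to the weight (`bijective_addPairsSeq`, `weight_addPairsSeq`). Both
counts contain the factor `1/(q^n;q^n)_∞`. Cancelling it equates the Primc generating function with
that of distinct parts weighted by odd positions, in which `n` no longer occurs
(`weightGenFun_primcSeq`). For `n = 1` there is one colour and `Δ = 0`, so Primc partitions are
ordinary partitions. -/

/-! ### Generating functions of weighted types. -/

/-- The generating function of a type with weight function `W`. -/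
noncomputable def weightGenFun {α : Type} (W : α → ℕ) : ℤ⟦X⟧ :=
  PowerSeries.mk fun k => (Nat.card {a // W a = k} : ℤ)

/-- There are finitely many elements of each weight. -/
def FiniteWeights {α : Type} (W : α → ℕ) : Prop := ∀ k, Finite {a // W a = k}

theorem FiniteWeights.of_injective {α β : Type} {W : α → ℕ} {W' : β → ℕ} (h : FiniteWeights W')
    (f : α → β) (hf : Function.Injective f) (hW : ∀ a, W' (f a) = W a) : FiniteWeights W := by
  intro k
  have := h k
  refine Finite.of_injective
    (fun a : {a // W a = k} => (⟨f a.1, (hW a.1).trans a.2⟩ : {b // W' b = k})) ?_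
  intro a b hab
  exact Subtype.ext (hf (congrArg Subtype.val hab))

/-- A bijection preserving weights, fibre by fibre. -/
noncomputable def weightFibreEquiv {α β : Type} {W : α → ℕ} {W' : β → ℕ} (f : α → β)
    (hf : Function.Bijective f) (hW : ∀ a, W' (f a) = W a) (k : ℕ) :
    {a // W a = k} ≃ {b // W' b = k} :=
  (Equiv.ofBijective f hf).subtypeEquiv fun a => by simp [hW]

theorem FiniteWeights.of_bijective {α β : Type} {W : α → ℕ} {W' : β → ℕ} (h : FiniteWeights W)
    (f : α → β) (hf : Function.Bijective f) (hW : ∀ a, W' (f a) = W a) : FiniteWeights W' := by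
  intro k
  have := h k
  exact Finite.of_equiv _ (weightFibreEquiv f hf hW k)

theorem weightGenFun_congr {α β : Type} {W : α → ℕ} {W' : β → ℕ} (f : α → β)
    (hf : Function.Bijective f) (hW : ∀ a, W' (f a) = W a) :
    weightGenFun W = weightGenFun W' := by
  ext k
  simp only [weightGenFun, coeff_mk]
  rw [Nat.card_congr (weightFibreEquiv f hf hW k)]

/-- The elements of total weight `k` of a product, sorted by the weights of their components. -/
def prodFibreEquiv {α β : Type} (W : α → ℕ) (W' : β → ℕ) (k : ℕ) :
    {x : α × β // W x.1 + W' x.2 = k} ≃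
      Σ p : Finset.HasAntidiagonal.antidiagonal k, {a // W a = p.1.1} × {b // W' b = p.1.2} where
  toFun x := ⟨⟨(W x.1.1, W' x.1.2), by simpa using x.2⟩, ⟨x.1.1, rfl⟩, ⟨x.1.2, rfl⟩⟩
  invFun y := ⟨(y.2.1.1, y.2.2.1), by
    have h := Finset.HasAntidiagonal.mem_antidiagonal.1 y.1.2
    rw [y.2.1.2, y.2.2.2]; exact h⟩
  left_inv x := rfl
  right_inv := by
    rintro ⟨⟨⟨i, j⟩, h⟩, ⟨a, ha⟩, ⟨b, hb⟩⟩
    change W a = i at ha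
    change W' b = j at hb
    subst ha hb
    rfl

theorem FiniteWeights.prod {α β : Type} {W : α → ℕ} {W' : β → ℕ} (h : FiniteWeights W)
    (h' : FiniteWeights W') : FiniteWeights fun x : α × β => W x.1 + W' x.2 := by
  intro k
  have := h
  have := h'
  unfold FiniteWeights at *
  exact Finite.of_equiv _ (prodFibreEquiv W W' k).symm

theorem weightGenFun_prod {α β : Type} {W : α → ℕ} {W' : β → ℕ} (h : FiniteWeights W)
    (h' : FiniteWeights W') :
    weightGenFun (fun x : α × β => W x.1 + W' x.2) = weightGenFun W * weightGenFun W' := by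
  ext k
  have := h
  have := h'
  unfold FiniteWeights at *
  simp only [weightGenFun, coeff_mk, coeff_mul]
  rw [Nat.card_congr (prodFibreEquiv W W' k), Nat.card_sigma]
  simp only [Nat.card_prod]
  push_cast
  exact Finset.sum_coe_sort (Finset.HasAntidiagonal.antidiagonal k)
    (fun p => (Nat.card {a // W a = p.1} : ℤ) * Nat.card {b // W' b = p.2})

theorem weightGenFun_ne_zero {α : Type} {W : α → ℕ} (h : FiniteWeights W) (a : α) :
    weightGenFun W ≠ 0 := by
  intro h0
  have h1 := congrArg (coeff (W a)) h0
  have := h (W a)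
  have : Nonempty {b // W b = W a} := ⟨⟨a, rfl⟩⟩
  have h2 : 0 < Nat.card {b // W b = W a} := Nat.card_pos
  simp [weightGenFun] at h1
  omega

/-! ### Ordinary partitions and Euler's product. -/

/-- Finite multisets of positive integers. -/
abbrev PosMultiset : Type := {m : Multiset ℕ // ∀ x ∈ m, 0 < x}

/-- The multisets of positive integers with sum `k` are the partitions of `k`. -/
def posMultisetFibreEquiv (k : ℕ) : {m : PosMultiset // m.1.sum = k} ≃ Nat.Partition k where
  toFun m := ⟨m.1.1, @fun _ hx => m.1.2 _ hx, m.2⟩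
  invFun p := ⟨⟨p.parts, fun _ hx => p.parts_pos hx⟩, p.parts_sum⟩
  left_inv _ := rfl
  right_inv _ := rfl

theorem finiteWeights_posMultiset : FiniteWeights fun m : PosMultiset => m.1.sum :=
  fun k => Finite.of_equiv _ (posMultisetFibreEquiv k).symm

theorem finiteWeights_mul_posMultiset {n : ℕ} (hn : 0 < n) :
    FiniteWeights fun m : PosMultiset => n * m.1.sum := by
  intro k
  have := finiteWeights_posMultiset (k / n)
  refine Finite.of_injective (fun m : {m : PosMultiset // n * m.1.sum = k} =>
    (⟨m.1, (Nat.div_eq_of_eq_mul_right hn m.2.symm).symm⟩ :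
      {m : PosMultiset // m.1.sum = k / n})) ?_
  intro a b hab
  exact Subtype.ext (congrArg (fun x => x.1) hab)

theorem weightGenFun_posMultiset_mul_qqInf :
    weightGenFun (fun m : PosMultiset => m.1.sum) * qqInf = 1 := by
  have h1 : weightGenFun (fun m : PosMultiset => m.1.sum)
      = Nat.Partition.genFun (fun _ _ => (1 : ℤ)) := by
    ext k
    rw [Nat.Partition.coeff_genFun]
    simp only [weightGenFun, coeff_mk]
    rw [Nat.card_congr (posMultisetFibreEquiv k)]
    simp [Finsupp.prod]
  have h2 := (Nat.Partition.hasProd_genFun (fun _ _ => (1 : ℤ))).mul multipliable_qqInf.hasProd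
  rw [h1]
  refine h2.unique ?_
  -- The two products cancel factor by factor: the geometric series in `X ^ (i + 1)` times `1 - X ^
  -- (i + 1)` is `1`.
  convert hasProd_one using 2 with i
  have hX : constantCoeff (X ^ (i + 1) : ℤ⟦X⟧) = 0 := by simp
  have h3 := WithPiTopology.tsum_pow_mul_one_sub_of_constantCoeff_eq_zero hX
  have h4 := WithPiTopology.summable_pow_of_constantCoeff_eq_zero hX
  rw [h4.tsum_eq_zero_add] at h3
  simpa [← pow_mul, smul_eq_C_mul] using h3

/-! ### Refining a generating function by a statistic. -/

/-- Sorting the elements of a type by a statistic `s` which determines their weights. -/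
theorem sumsToInvQq_of_statistic {α ι : Type} {W : α → ℕ} (hfin : FiniteWeights W)
    (hW : weightGenFun W * qqInf = 1) (s : α → ι) (c : ι → ℕ) (e : ι → ℤ)
    (hc : ∀ i, c i = Nat.card {a // s a = i}) (he : ∀ a, e (s a) = W a) : SumsToInvQq c e := by
  have hmem : ∀ i, c i ≠ 0 → ∃ a, s a = i := by
    intro i hi
    rw [hc] at hi
    obtain ⟨⟨a, ha⟩⟩ := (Nat.card_ne_zero.1 hi).1
    exact ⟨a, ha⟩
  refine ⟨?_, _, hW, ?_⟩
  · intro i hi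
    obtain ⟨a, rfl⟩ := hmem i hi
    rw [he]
    positivity
  · rw [WithPiTopology.hasSum_iff_hasSum_coeff]
    intro k
    have := hfin k
    -- Only the values of `s` attained at weight `k` contribute to the coefficient of `X ^ k`, and
    -- they are finitely many.
    let T : Finset ι := (Set.toFinite (Set.range fun a : {a // W a = k} => s a.1)).toFinset
    have hT : ∀ i, i ∈ T ↔ ∃ a, W a = k ∧ s a = i := by
      intro i
      simp [T]
    have hterm : ∀ i, coeff k ((c i : ℤ⟦X⟧) * X ^ (e i).toNat)
        = if (e i).toNat = k then (c i : ℤ) else 0 := by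
      intro i
      rw [← map_natCast (C : ℤ →+* ℤ⟦X⟧), coeff_C_mul, coeff_X_pow]
      simp [eq_comm]
    simp only [hterm]
    have hzero : ∀ i ∉ T, (if (e i).toNat = k then (c i : ℤ) else 0) = 0 := by
      intro i hi
      split_ifs with hk
      · by_contra h0
        obtain ⟨a, rfl⟩ := hmem i (by exact_mod_cast h0)
        exact hi ((hT _).2 ⟨a, by rw [he] at hk; simpa using hk, rfl⟩)
      · rfl
    -- Since `s` determines the weight, the whole fibre of `s` over a value in `T` has weight `k`.
    have hsum : ∀ i ∈ T, (if (e i).toNat = k then (c i : ℤ) else 0)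
        = (Nat.card {a : {a // W a = k} // s a.1 = i} : ℤ) := by
      intro i hi
      obtain ⟨b, hb, rfl⟩ := (hT i).1 hi
      rw [if_pos (by rw [he, hb]; simp), hc]
      congr 1
      refine Nat.card_congr ⟨fun a => ⟨⟨a.1, ?_⟩, a.2⟩, fun a => ⟨a.1.1, a.2⟩, fun _ => rfl,
        fun _ => rfl⟩
      have h1 := he a.1
      rw [a.2, he, hb] at h1
      exact_mod_cast h1.symm
    have key := hasSum_sum_of_ne_finset_zero (L := SummationFilter.unconditional ι) hzero
    rw [Finset.sum_congr rfl hsum] at key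
    have hG : coeff k (weightGenFun W)
        = ∑ i ∈ T, (Nat.card {a : {a // W a = k} // s a.1 = i} : ℤ) := by
      let E : {a // W a = k} ≃ Σ i : T, {a : {a // W a = k} // s a.1 = i} :=
        ⟨fun a => ⟨⟨s a.1, (hT _).2 ⟨a.1, a.2, rfl⟩⟩, a, rfl⟩, fun x => x.2.1, fun _ => rfl, by
          rintro ⟨⟨i, hi⟩, a, ha⟩
          change s a.1 = i at ha
          subst ha
          rfl⟩
      simp only [weightGenFun, coeff_mk]
      rw [Nat.card_congr E, Nat.card_sigma]
      push_cast
      exact Finset.sum_coe_sort T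
        (fun i => (Nat.card {a : {a // W a = k} // s a.1 = i} : ℤ))
    rw [hG]
    exact key

/-! ### Finite lists as eventually constant sequences. -/

section Sequences

variable {α : Type} {g : α}

theorem exists_list_of_eventually_eq {s : ℕ → α} (hs : ∃ L, ∀ j ≥ L, s j = g)
    (htrim : ∀ j, s j = g → s (j + 1) = g) :
    ∃ l : List α, g ∉ l ∧ ∀ j, l.getD j g = s j := by
  obtain ⟨L, hL⟩ := hs
  induction L generalizing s with
  | zero => exact ⟨[], by simp, fun j => by simp [hL j (Nat.zero_le j)]⟩
  | succ L ih =>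
    by_cases h0 : s 0 = g
    · refine ⟨[], by simp, fun j => ?_⟩
      have : s j = g := by
        induction j with
        | zero => exact h0
        | succ j ihj => exact htrim j ihj
      simp [this]
    · obtain ⟨l, hl, hl'⟩ := ih (s := fun j => s (j + 1)) (fun j => htrim (j + 1))
        (fun j hj => hL (j + 1) (by omega))
      refine ⟨s 0 :: l, ?_, ?_⟩
      · simp only [List.mem_cons, not_or]
        exact ⟨fun h => h0 h.symm, hl⟩
      · rintro (_ | j)
        · simp
        · simpa using hl' j

theorem list_eq_of_getD_eq {l l' : List α} (hl : g ∉ l) (hl' : g ∉ l')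
    (h : ∀ j, l.getD j g = l'.getD j g) : l = l' := by
  induction l generalizing l' with
  | nil =>
    cases l' with
    | nil => rfl
    | cons a t =>
      have := h 0
      simp at this
      simp [this] at hl'
  | cons a t ih =>
    cases l' with
    | nil =>
      have := h 0
      simp at this
      simp [this] at hl
    | cons a' t' =>
      have h0 := h 0
      simp only [List.getD_cons_zero] at h0
      simp only [List.mem_cons, not_or] at hl hl'
      rw [h0, ih hl.2 hl'.2 fun j => by simpa using h (j + 1)]

theorem getD_eventually_eq (l : List α) : ∃ L, ∀ j ≥ L, l.getD j g = g :=
  ⟨l.length, fun j hj => by simp [List.getD, List.getElem?_eq_none hj]⟩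

theorem getD_mem_or_eq (l : List α) (j : ℕ) : l.getD j g ∈ l ∨ l.getD j g = g := by
  rcases lt_or_ge j l.length with h | h
  · left
    simp [List.getD, List.getElem?_eq_getElem h]
  · right
    simp [List.getD, List.getElem?_eq_none h]

theorem exists_getD_eq_of_mem {l : List α} {x : α} (hx : x ∈ l) : ∃ j, l.getD j g = x := by
  obtain ⟨j, hj, rfl⟩ := List.getElem_of_mem hx
  exact ⟨j, by simp [List.getD, List.getElem?_eq_getElem hj]⟩

/-- Padding by `g` adds only the steps from the last entry to `g` and from `g` to `g`, which the
hypotheses allow. -/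
theorem isChain_iff_getD {R : α → α → Prop} (hg : R g g) {l : List α} (hl : ∀ x ∈ l, R x g) :
    l.IsChain R ↔ ∀ j, R (l.getD j g) (l.getD (j + 1) g) := by
  induction l with
  | nil => simpa using hg
  | cons a t ih =>
    have ih := ih fun x hx => hl x (by simp [hx])
    cases t with
    | nil =>
      simp only [List.IsChain.singleton, true_iff]
      rintro (_ | j)
      · simpa using hl a (by simp)
      · simpa using hg
    | cons b t =>
      rw [List.isChain_cons_cons, ih]
      constructor
      · rintro ⟨h, h'⟩ (_ | j)
        · simpa using h
        · simpa using h' j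
      · intro h
        exact ⟨by simpa using h 0, fun j => by simpa using h (j + 1)⟩

theorem summable_of_eventually_zero {f : ℕ → ℕ} (hf : ∃ L, ∀ j ≥ L, f j = 0) : Summable f := by
  obtain ⟨L, hL⟩ := hf
  exact summable_of_ne_finset_zero (s := Finset.range L) fun j hj => hL j (by simpa using hj)

theorem tsum_eq_head_add {f : ℕ → ℕ} (hf : ∃ L, ∀ j ≥ L, f j = 0) :
    ∑' j, f j = f 0 + ∑' j, f (j + 1) := by
  obtain ⟨L, hL⟩ := hf
  exact _root_.tsum_eq_zero_add'
    (summable_of_eventually_zero ⟨L, fun j hj => hL (j + 1) (by omega)⟩)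

theorem tsum_getD (f : α → ℕ) (hf : f g = 0) (l : List α) :
    ∑' j, f (l.getD j g) = (l.map f).sum := by
  induction l with
  | nil => simp [hf]
  | cons a t ih =>
    obtain ⟨L, hL⟩ := getD_eventually_eq (g := g) (a :: t)
    rw [tsum_eq_head_add ⟨L, fun j hj => by rw [hL j hj, hf]⟩]
    simp only [List.getD_cons_zero, List.getD_cons_succ, List.map_cons, List.sum_cons]
    rw [ih]

end Sequences

/-! ### Sums over odd positions and conjugate partitions. -/

/-- The sum of the entries in odd position of a list, the first entry being in position one. -/
def altSum : List ℕ → ℕ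
  | [] => 0
  | [x] => x
  | x :: _ :: t => x + altSum t

theorem tsum_getD_two_mul : ∀ l : List ℕ, ∑' j, l.getD (2 * j) 0 = altSum l
  | [] => by simp [altSum]
  | [x] => by
    rw [tsum_eq_head_add ⟨1, fun j hj => by
      obtain ⟨i, rfl⟩ : ∃ i, j = i + 1 := ⟨j - 1, by omega⟩
      simp [mul_add]⟩]
    simp [altSum, mul_add]
  | x :: y :: t => by
    obtain ⟨L, hL⟩ := getD_eventually_eq (g := 0) (x :: y :: t)
    rw [tsum_eq_head_add ⟨L, fun j hj => hL (2 * j) (by omega)⟩]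
    simp only [mul_add, mul_one, mul_zero, List.getD_cons_zero, List.getD_cons_succ, altSum]
    rw [tsum_getD_two_mul t]

/-- For a list in decreasing order, the sum of the entries in odd position in terms of the
conjugate partition. -/
theorem altSum_eq_sum_countP (B : ℕ) : ∀ l : List ℕ, l.Pairwise (· ≥ ·) → (∀ x ∈ l, x ≤ B) →
    altSum l = ∑ v ∈ Finset.range B, (l.countP (fun x => v < x) + 1) / 2
  | [], _, _ => by simp [altSum]
  | [x], _, hB => by
    have hx := hB x (by simp)
    have h1 : ∀ v ∈ Finset.range B,
        (List.countP (fun x => decide (v < x)) [x] + 1) / 2 = if v < x then 1 else 0 := by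
      intro v _
      by_cases h : v < x <;> simp [h]
    rw [Finset.sum_congr rfl h1, Finset.sum_boole]
    have h2 : (Finset.range B).filter (fun v => v < x) = Finset.range x := by
      ext v; simp; omega
    simp [altSum, h2]
  | x :: y :: t, hl, hB => by
    have hx := hB x (by simp)
    rw [List.pairwise_cons, List.pairwise_cons] at hl
    obtain ⟨hl1, hl2, hl3⟩ := hl
    have hyx := hl1 y (by simp)
    -- Removing the two largest entries lowers the rounded-up half by one exactly when `v < x`: if
    -- `y ≤ v`, then no later entry exceeds `v` either.
    have h1 : ∀ v ∈ Finset.range B,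
        ((x :: y :: t).countP (fun x => decide (v < x)) + 1) / 2
          = (if v < x then 1 else 0) + (t.countP (fun x => decide (v < x)) + 1) / 2 := by
      intro v _
      simp only [List.countP_cons, decide_eq_true_eq]
      by_cases hy : v < y
      · have : v < x := by omega
        simp only [hy, this, if_true]
        omega
      · have : t.countP (fun x => decide (v < x)) = 0 := by
          rw [List.countP_eq_zero]
          intro z hz
          have := hl2 z hz
          simp
          omega
        by_cases hvx : v < x <;> simp [hy, hvx, this]
    rw [Finset.sum_congr rfl h1, Finset.sum_add_distrib, Finset.sum_boole, altSum,
      altSum_eq_sum_countP B t hl3 fun z hz => hB z (by simp [hz])]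
    have h2 : (Finset.range B).filter (fun v => v < x) = Finset.range x := by
      ext v; simp; omega
    simp [h2]

theorem sum_countP_lt (B : ℕ) (m : Multiset ℕ) (hB : ∀ x ∈ m, x ≤ B) :
    ∑ v ∈ Finset.range B, m.countP (fun x => v < x) = m.sum := by
  induction m using Multiset.induction with
  | empty => simp
  | cons a m ih =>
    have ha := hB a (by simp)
    simp only [Multiset.countP_cons, Finset.sum_add_distrib, Multiset.sum_cons]
    rw [ih fun x hx => hB x (by simp [hx]), Finset.sum_boole]
    have h2 : (Finset.range B).filter (fun v => v < a) = Finset.range a := by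
      ext v; simp; omega
    simp [h2, add_comm]

/-! ### The local step: difference conditions as inequalities between entries. -/

/-- A part together with its colour `a_i b_k`, written as `(size, i, k)`. -/
abbrev PrimcState (n : ℕ) : Type := ℕ × Fin n × Fin n

/-- The size of a part `(K, i, k)` after dilation. -/
def dilate {n : ℕ} (p : PrimcState n) : ℤ := n * p.1 - (p.2.1 : ℕ) + (p.2.2 : ℕ)

/-- The contribution to `Δ` of the symbols `a`. -/
def deltaA (i k i' : ℕ) : ℤ := (if i ≥ i' then 1 else 0) - (if i = k ∧ k = i' then 1 else 0)

/-- The contribution to `Δ` of the symbols `b`. -/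
def deltaB (k i' k' : ℕ) : ℤ := (if k ≤ k' then 1 else 0) - (if k = i' ∧ i' = k' then 1 else 0)

theorem primcDelta_eq (i k i' k' : ℕ) : primcDelta i k i' k' = deltaA i k i' + deltaB k i' k' := by
  unfold primcDelta deltaA deltaB
  ring

/-- The part of size zero only occurs with the colour `a_0 b_0`. -/
def IsPartOrGround {n : ℕ} [NeZero n] (p : PrimcState n) : Prop := p.1 = 0 → p = (0, 0, 0)

/-- The entry in odd position attached to a part and a multiple of `n`. -/
def oddEntry {n : ℕ} (p : PrimcState n) (x : ℕ) : ℤ := dilate p + n * x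

/-- The entry in even position attached to a part, the part after it and a multiple of `n`. -/
def evenEntry {n : ℕ} (p p' : PrimcState n) (x : ℕ) : ℤ :=
  dilate p' + n * deltaB p.2.2 p'.2.1 p'.2.2 + (p.2.2 : ℕ) - (p'.2.2 : ℕ) + n * x

/-- As `|d| < n`, the sign of `n * x + d` is decided by `x`, and `d` only breaks the tie at `x = 0`.
-/
theorem mul_add_nonneg_iff {n x d : ℤ} (h1 : -n < d) (h2 : d < n) :
    0 ≤ n * x + d ↔ 0 ≤ x ∧ (d < 0 → 1 ≤ x) := by
  constructor
  · intro h
    have hx : 0 ≤ x := by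
      by_contra hx
      nlinarith
    refine ⟨hx, fun hd => ?_⟩
    by_contra hx'
    have : x = 0 := by omega
    subst this
    omega
  · rintro ⟨hx, hd⟩
    rcases lt_or_ge d 0 with h | h
    · nlinarith [hd h]
    · nlinarith

theorem mul_add_eq_zero_iff {n x d : ℤ} (h1 : -n < d) (h2 : d < n) :
    n * x + d = 0 ↔ x = 0 ∧ d = 0 := by
  constructor
  · intro h
    have hx : x = 0 := by
      rcases lt_trichotomy x 0 with hx | hx | hx
      · nlinarith
      · exact hx
      · nlinarith
    subst hx
    simpa using h
  · rintro ⟨rfl, rfl⟩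
    simp

/-- The right-hand side is what an admissible step of size `n * z + (k - k')` amounts to: it is
nonnegative, and if it vanishes then `i' = k'`, so that the odd entry of the next part is a multiple
of `n`. `deltaA_le_iff` plays the same role with `i' - i` and the current part. This is where the
two halves of `Δ` come from. -/
theorem deltaB_le_iff (z : ℤ) (k i' k' : ℕ) : deltaB k i' k' ≤ z ↔
    (0 ≤ z ∧ ((k : ℤ) - k' < 0 → 1 ≤ z)) ∧ (z = 0 ∧ (k : ℤ) - k' = 0 → i' = k') := by
  unfold deltaB
  split_ifs <;> omega

theorem deltaA_le_iff (z : ℤ) (i k i' : ℕ) : deltaA i k i' ≤ z ↔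
    (0 ≤ z ∧ ((i' : ℤ) - i < 0 → 1 ≤ z)) ∧ (z = 0 ∧ (i' : ℤ) - i = 0 → i = k) := by
  unfold deltaA
  split_ifs <;> omega

theorem primcDiff_nonneg {n : ℕ} (c c' : Fin n × Fin n) : 0 ≤ primcDiff n c c' := by
  rw [primcDiff, primcDelta_eq]
  have h1 := (deltaA_le_iff _ c.1 c.2 c'.1).1 le_rfl
  have h2 := (deltaB_le_iff _ c.2 c'.1 c'.2).1 le_rfl
  omega

section Step

variable {n : ℕ} {p p' q q' : PrimcState n} {x x' y : ℕ}

theorem dvd_oddEntry_iff : (n : ℤ) ∣ oddEntry p x ↔ (p.2.1 : ℕ) = p.2.2 := by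
  have hi := p.2.1.2
  have hk := p.2.2.2
  constructor
  · rintro ⟨c, hc⟩
    have h := (mul_add_eq_zero_iff (n := n) (x := p.1 + x - c)
      (d := (p.2.2 : ℕ) - (p.2.1 : ℕ)) (by omega) (by omega)).1 (by
        unfold oddEntry dilate at hc
        linear_combination hc)
    omega
  · intro h
    refine ⟨p.1 + x, ?_⟩
    unfold oddEntry dilate
    rw [h]
    ring

theorem evenEntry_sub_oddEntry : evenEntry p p' x - oddEntry p' x'
    = n * (deltaB p.2.2 p'.2.1 p'.2.2 + x - x') + ((p.2.2 : ℕ) - (p'.2.2 : ℕ)) := by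
  unfold evenEntry oddEntry
  ring

theorem oddEntry_sub_evenEntry : oddEntry p x - evenEntry p p' x
    = n * (p.1 - p'.1 - deltaB p.2.2 p'.2.1 p'.2.2) + ((p'.2.1 : ℕ) - (p.2.1 : ℕ)) := by
  unfold evenEntry oddEntry dilate
  ring

theorem le_iff_evenEntry : x' ≤ x ↔ oddEntry p' x' ≤ evenEntry p p' x ∧
    (evenEntry p p' x = oddEntry p' x' → (n : ℤ) ∣ oddEntry p' x') := by
  have hk := p.2.2.2
  have hk' := p'.2.2.2
  rw [← sub_nonneg (a := evenEntry p p' x), ← sub_eq_zero (a := evenEntry p p' x),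
    evenEntry_sub_oddEntry (x' := x'), mul_add_nonneg_iff (by omega) (by omega),
    mul_add_eq_zero_iff (by omega) (by omega), dvd_oddEntry_iff, ← deltaB_le_iff]
  omega

theorem primcDiff_le_iff_oddEntry : primcDiff n p.2 p'.2 ≤ (p.1 : ℤ) - p'.1 ↔
    evenEntry p p' x ≤ oddEntry p x ∧
    (oddEntry p x = evenEntry p p' x → (n : ℤ) ∣ oddEntry p x) := by
  have hi := p.2.1.2
  have hi' := p'.2.1.2
  rw [← sub_nonneg (a := oddEntry p x), ← sub_eq_zero (a := oddEntry p x),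
    oddEntry_sub_evenEntry, mul_add_nonneg_iff (by omega) (by omega),
    mul_add_eq_zero_iff (by omega) (by omega), dvd_oddEntry_iff, ← deltaA_le_iff,
    primcDiff, primcDelta_eq]
  omega

/-- With `p'` known, the even entry fixes `k` mod `n`, hence `deltaB` and then `x`; the odd entry
then fixes `i` mod `n` and finally the size. -/
theorem eq_of_entries_eq (h1 : oddEntry p x = oddEntry q y)
    (h2 : evenEntry p p' x = evenEntry q p' y) : p = q ∧ x = y := by
  obtain ⟨K, i, k⟩ := p
  obtain ⟨K2, i2, k2⟩ := q
  have hi := i.2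
  have hk := k.2
  have hi2 := i2.2
  have hk2 := k2.2
  simp only [evenEntry] at h2
  have h3 := (mul_add_eq_zero_iff (n := n)
    (x := deltaB k p'.2.1 p'.2.2 + x - (deltaB k2 p'.2.1 p'.2.2 + y))
    (d := (k : ℕ) - (k2 : ℕ)) (by omega) (by omega)).1 (by linear_combination h2)
  have hkk : k = k2 := Fin.ext (by omega)
  subst hkk
  have hxy : x = y := by omega
  subst hxy
  simp only [oddEntry, dilate] at h1
  have h4 := (mul_add_eq_zero_iff (n := n) (x := (K : ℤ) - K2)
    (d := (i2 : ℕ) - (i : ℕ)) (by omega) (by omega)).1 (by linear_combination h1)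
  have hii : i = i2 := Fin.ext (by omega)
  subst hii
  have hKK : K = K2 := by omega
  subst hKK
  exact ⟨rfl, rfl⟩

theorem dilate_nonneg [NeZero n] (hp : IsPartOrGround p) : 0 ≤ dilate p := by
  by_cases h : p.1 = 0
  · rw [hp h]
    simp [dilate]
  · have hi := p.2.1.2
    have : (1 : ℤ) ≤ p.1 := by omega
    unfold dilate
    nlinarith

/-- As `Δ ≥ 0`, size zero forces `p'` to be the ground part, and `deltaA i k 0 ≤ 0` then forces `i =
k = 0`. -/
theorem isPartOrGround_of_diff [NeZero n] (hp' : IsPartOrGround p')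
    (h : primcDiff n p.2 p'.2 ≤ (p.1 : ℤ) - p'.1) : IsPartOrGround p := by
  intro h0
  obtain ⟨K, i, k⟩ := p
  simp only at h0
  subst h0
  rw [primcDiff, primcDelta_eq] at h
  have h1 := (deltaA_le_iff _ i k p'.2.1).1 le_rfl
  have h2 := (deltaB_le_iff _ k p'.2.1 p'.2.2).1 le_rfl
  have h3 := hp' (by simp only at h; push_cast at h; omega)
  subst h3
  have h4 := (deltaA_le_iff 0 i k (0 : Fin n)).1 (by simp only at h h1 h2; push_cast at h; omega)
  rw [Fin.val_zero] at h4
  have hi : (i : ℕ) = 0 := by omega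
  have hk : (k : ℕ) = 0 := by omega
  have hk' : k = 0 := Fin.ext (by simpa using hk)
  have hi' : i = 0 := Fin.ext (by simpa using hi)
  rw [hk', hi']

theorem exists_entries_eq [NeZero n] (hp' : IsPartOrGround p') {z₁ z₂ : ℤ}
    (h1 : oddEntry p' x' ≤ z₂) (h2 : z₂ = oddEntry p' x' → (n : ℤ) ∣ oddEntry p' x')
    (h3 : z₂ ≤ z₁) (h4 : z₁ = z₂ → (n : ℤ) ∣ z₁) :
    ∃ (p : PrimcState n) (x : ℕ), IsPartOrGround p ∧ x' ≤ x ∧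
      primcDiff n p.2 p'.2 ≤ (p.1 : ℤ) - p'.1 ∧ evenEntry p p' x = z₂ ∧ oddEntry p x = z₁ := by
  have hn : 0 < (n : ℤ) := by exact_mod_cast Nat.pos_of_ne_zero (NeZero.ne n)
  -- The residue of `z₂` determines `k`; the quotient `t` will be `deltaB` plus the multiplier `x`.
  obtain ⟨k, t, ht⟩ : ∃ (k : Fin n) (t : ℤ), z₂ = dilate p' - (p'.2.2 : ℕ) + n * t + (k : ℕ) := by
    set s := z₂ - dilate p' + (p'.2.2 : ℕ) with hs
    have e1 := Int.emod_nonneg s hn.ne'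
    have e2 := Int.emod_lt_of_pos s hn
    refine ⟨⟨(s % n).toNat, by omega⟩, s / n, ?_⟩
    have e3 := Int.mul_ediv_add_emod s n
    simp only [Int.toNat_of_nonneg e1]
    linarith
  -- Once `k` is known, the residue of `z₁` determines `i`; the quotient `r` will be the size plus
  -- `x`.
  obtain ⟨i, r, hr⟩ : ∃ (i : Fin n) (r : ℤ), z₁ = n * r - (i : ℕ) + (k : ℕ) := by
    set s := (k : ℕ) - z₁ with hs
    have e1 := Int.emod_nonneg s hn.ne'
    have e2 := Int.emod_lt_of_pos s hn
    refine ⟨⟨(s % n).toNat, by omega⟩, -(s / n), ?_⟩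
    have e3 := Int.mul_ediv_add_emod s n
    simp only [Int.toNat_of_nonneg e1]
    linarith
  have hk := k.2
  have hi := i.2
  have hk' := p'.2.2.2
  have hi' := p'.2.1.2
  set b := deltaB k p'.2.1 p'.2.2 with hb
  -- the multiple of `n`
  have hx : (x' : ℤ) ≤ t - b := by
    have e : z₂ - oddEntry p' x' = n * (t - x') + ((k : ℕ) - (p'.2.2 : ℕ)) := by
      rw [ht]; unfold oddEntry; ring
    rw [dvd_oddEntry_iff] at h2
    rw [← sub_nonneg, e, mul_add_nonneg_iff (by omega) (by omega)] at h1
    rw [← sub_eq_zero, e, mul_add_eq_zero_iff (by omega) (by omega)] at h2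
    have := (deltaB_le_iff (t - x') k p'.2.1 p'.2.2).2 ⟨h1, h2⟩
    omega
  obtain ⟨x, hxt⟩ : ∃ x : ℕ, (x : ℤ) = t - b := ⟨(t - b).toNat, by omega⟩
  have hK : primcDiff n (i, k) p'.2 ≤ r - x - p'.1 := by
    have e : z₁ - z₂ = n * (r - x - p'.1 - b) + ((p'.2.1 : ℕ) - (i : ℕ)) := by
      rw [ht, hr, hxt]; unfold dilate; ring
    have hdvd : (n : ℤ) ∣ z₁ → (i : ℕ) = k := by
      rintro ⟨c, hc⟩
      have h := (mul_add_eq_zero_iff (n := n) (x := r - c)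
        (d := (k : ℕ) - (i : ℕ)) (by omega) (by omega)).1 (by linear_combination hc - hr)
      omega
    rw [← sub_nonneg, e, mul_add_nonneg_iff (by omega) (by omega)] at h3
    rw [← sub_eq_zero, e, mul_add_eq_zero_iff (by omega) (by omega)] at h4
    have := (deltaA_le_iff _ i k p'.2.1).2 ⟨h3, fun h => hdvd (h4 h)⟩
    rw [primcDiff, primcDelta_eq]
    simp only
    omega
  have hpos := primcDiff_nonneg (i, k) p'.2
  obtain ⟨K, hKr⟩ : ∃ K : ℕ, (K : ℤ) = r - x := ⟨(r - x).toNat, by omega⟩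
  have hd : primcDiff n (i, k) p'.2 ≤ (K : ℤ) - p'.1 := by omega
  refine ⟨(K, i, k), x, isPartOrGround_of_diff hp' hd, by omega, hd, ?_, ?_⟩
  · simp only [evenEntry]
    rw [← hb, ht, hxt]
    ring
  · simp only [oddEntry, dilate]
    rw [hr, hKr]
    ring

end Step

/-! ### The interleaving bijection. -/

/-- Generalised Primc partitions, continued by parts of size zero and colour `a_0 b_0`. -/
def PrimcSeq (n : ℕ) [NeZero n] : Type := {p : ℕ → PrimcState n //
  (∃ L, ∀ j ≥ L, p j = (0, 0, 0)) ∧ ∀ j, IsPartOrGround (p j) ∧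
    primcDiff n (p j).2 (p (j + 1)).2 ≤ ((p j).1 : ℤ) - (p (j + 1)).1}

/-- Partitions, continued by zeros. -/
def PartitionSeq : Type := {x : ℕ → ℕ // (∃ L, ∀ j ≥ L, x j = 0) ∧ ∀ j, x (j + 1) ≤ x j}

/-- Partitions, continued by zeros, in which only multiples of `n` are repeated. -/
def MultRepeatSeq (n : ℕ) : Type := {z : ℕ → ℕ // (∃ L, ∀ j ≥ L, z j = 0) ∧
  ∀ j, z (j + 1) ≤ z j ∧ (z j = z (j + 1) → n ∣ z j)}

/-- The sum of the dilated parts. -/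
noncomputable def PrimcSeq.weight {n : ℕ} [NeZero n] (p : PrimcSeq n) : ℕ :=
  ∑' j, (dilate (p.1 j)).toNat

/-- The sum of the parts. -/
noncomputable def PartitionSeq.weight (x : PartitionSeq) : ℕ := ∑' j, x.1 j

/-- The sum of the parts in odd position. -/
noncomputable def MultRepeatSeq.weight {n : ℕ} (z : MultRepeatSeq n) : ℕ := ∑' j, z.1 (2 * j)

section Interleave

variable {n : ℕ}

/-- The sequence alternating between odd and even entries. -/
def interleave (p : ℕ → PrimcState n) (x : ℕ → ℕ) (m : ℕ) : ℕ :=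
  if m % 2 = 0 then (oddEntry (p (m / 2)) (x (m / 2))).toNat
  else (evenEntry (p (m / 2)) (p (m / 2 + 1)) (x (m / 2))).toNat

theorem interleave_two_mul (p : ℕ → PrimcState n) (x : ℕ → ℕ) (j : ℕ) :
    interleave p x (2 * j) = (oddEntry (p j) (x j)).toNat := by
  simp [interleave]

theorem interleave_two_mul_add_one (p : ℕ → PrimcState n) (x : ℕ → ℕ) (j : ℕ) :
    interleave p x (2 * j + 1) = (evenEntry (p j) (p (j + 1)) (x j)).toNat := by
  have h1 : (2 * j + 1) % 2 = 1 := by omega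
  have h2 : (2 * j + 1) / 2 = j := by omega
  simp [interleave, h1, h2]

theorem interleave_add_two (p : ℕ → PrimcState n) (x : ℕ → ℕ) (m : ℕ) :
    interleave p x (m + 2) = interleave (fun j => p (j + 1)) (fun j => x (j + 1)) m := by
  have h1 : (m + 2) % 2 = m % 2 := by omega
  have h2 : (m + 2) / 2 = m / 2 + 1 := by omega
  simp [interleave, h1, h2]

variable [NeZero n]

theorem oddEntry_nonneg {p : PrimcState n} (hp : IsPartOrGround p) (x : ℕ) : 0 ≤ oddEntry p x := by
  have := dilate_nonneg hp
  unfold oddEntry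
  positivity

theorem oddEntry_ground : oddEntry ((0, 0, 0) : PrimcState n) 0 = 0 := by
  simp [oddEntry, dilate]

theorem evenEntry_ground : evenEntry ((0, 0, 0) : PrimcState n) (0, 0, 0) 0 = 0 := by
  simp [evenEntry, dilate, deltaB]

variable (p : PrimcSeq n) (x : PartitionSeq)

theorem cast_interleave_two_mul (j : ℕ) :
    (interleave p.1 x.1 (2 * j) : ℤ) = oddEntry (p.1 j) (x.1 j) := by
  rw [interleave_two_mul]
  exact Int.toNat_of_nonneg (oddEntry_nonneg (p.2.2 j).1 _)

theorem cast_interleave_two_mul_add_one (j : ℕ) :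
    (interleave p.1 x.1 (2 * j + 1) : ℤ) = evenEntry (p.1 j) (p.1 (j + 1)) (x.1 j) := by
  rw [interleave_two_mul_add_one]
  have h1 := oddEntry_nonneg (p.2.2 (j + 1)).1 (x.1 (j + 1))
  -- An even entry is nonnegative because it is at least the odd entry that follows it.
  have h2 := (le_iff_evenEntry (p := p.1 j) (p' := p.1 (j + 1))).1 (x.2.2 j)
  exact Int.toNat_of_nonneg (by omega)

theorem interleave_step (m : ℕ) : interleave p.1 x.1 (m + 1) ≤ interleave p.1 x.1 m ∧
    (interleave p.1 x.1 m = interleave p.1 x.1 (m + 1) → n ∣ interleave p.1 x.1 m) := by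
  obtain ⟨j, rfl | rfl⟩ := Nat.even_or_odd' m
  · have h := (primcDiff_le_iff_oddEntry (x := x.1 j)).1 (p.2.2 j).2
    rw [← cast_interleave_two_mul, ← cast_interleave_two_mul_add_one] at h
    exact_mod_cast h
  · have h := (le_iff_evenEntry (p := p.1 j) (p' := p.1 (j + 1))).1 (x.2.2 j)
    rw [← cast_interleave_two_mul, ← cast_interleave_two_mul_add_one] at h
    rw [show 2 * j + 1 + 1 = 2 * (j + 1) by ring]
    refine ⟨by exact_mod_cast h.1, fun he => ?_⟩
    have := h.2 (by exact_mod_cast he)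
    rw [he]
    exact_mod_cast this

/-- The sequence alternating between odd and even entries, as a partition in which only multiples of
`n` are repeated. -/
def interleaveSeq (y : PrimcSeq n × PartitionSeq) : MultRepeatSeq n :=
  ⟨interleave y.1.1 y.2.1, by
    obtain ⟨L, hL⟩ := y.1.2.1
    obtain ⟨M, hM⟩ := y.2.2.1
    refine ⟨2 * (L + M), fun m hm => ?_⟩
    have h1 : L ≤ m / 2 := by omega
    have h2 : M ≤ m / 2 := by omega
    unfold interleave
    rw [hL _ h1, hL _ (h1.trans (Nat.le_succ _)), hM _ h2, oddEntry_ground, evenEntry_ground]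
    simp, interleave_step y.1 y.2⟩

theorem interleaveSeq_injective : Function.Injective (interleaveSeq (n := n)) := by
  rintro ⟨p, x⟩ ⟨q, y⟩ h
  have h : interleave p.1 x.1 = interleave q.1 y.1 := congrArg Subtype.val h
  obtain ⟨L₁, hL₁⟩ := p.2.1
  obtain ⟨L₂, hL₂⟩ := x.2.1
  obtain ⟨L₃, hL₃⟩ := q.2.1
  obtain ⟨L₄, hL₄⟩ := y.2.1
  -- The entries determine a part only once the next part is known, so the induction runs from the
  -- common ground tail back to the head.
  have key : ∀ d j, L₁ + L₂ + L₃ + L₄ ≤ j + d → p.1 j = q.1 j ∧ x.1 j = y.1 j := by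
    intro d
    induction d with
    | zero =>
      intro j hj
      rw [hL₁ j (by omega), hL₂ j (by omega), hL₃ j (by omega), hL₄ j (by omega)]
      exact ⟨rfl, rfl⟩
    | succ d ih =>
      intro j hj
      have h1 := cast_interleave_two_mul p x j
      have h2 := cast_interleave_two_mul_add_one p x j
      rw [h, cast_interleave_two_mul q y] at h1
      rw [h, cast_interleave_two_mul_add_one q y, (ih (j + 1) (by omega)).1] at h2
      exact eq_of_entries_eq h1.symm h2.symm
  refine Prod.ext (Subtype.ext (funext fun j => ?_)) (Subtype.ext (funext fun j => ?_))
  · exact (key _ j (Nat.le_add_left _ _)).1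
  · exact (key _ j (Nat.le_add_left _ _)).2

theorem interleaveSeq_surjective : Function.Surjective (interleaveSeq (n := n)) := by
  -- Induction on the number of pairs of entries: a preimage of `z` without its first two entries is
  -- extended by one part and one multiplier from `exists_entries_eq`.
  have key : ∀ (L : ℕ) (z : MultRepeatSeq n), (∀ m ≥ 2 * L, z.1 m = 0) →
      ∃ y : PrimcSeq n × PartitionSeq, (interleaveSeq y).1 = z.1 := by
    intro L
    induction L with
    | zero =>
      intro z hz
      refine ⟨(⟨fun _ => (0, 0, 0), ⟨0, fun _ _ => rfl⟩, fun _ => ⟨fun _ => rfl, ?_⟩⟩,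
        ⟨fun _ => 0, ⟨0, fun _ _ => rfl⟩, fun _ => le_rfl⟩), ?_⟩
      · simp [primcDiff, primcDelta]
      · funext m
        rw [hz m (Nat.zero_le _)]
        simp [interleaveSeq, interleave, oddEntry_ground, evenEntry_ground]
    | succ L ih =>
      intro z hz
      obtain ⟨Lz, hLz⟩ := z.2.1
      obtain ⟨⟨p', x'⟩, hy⟩ := ih ⟨fun m => z.1 (m + 2),
        ⟨Lz, fun j hj => hLz _ (by omega)⟩, fun j => z.2.2 (j + 2)⟩
        (fun m hm => hz _ (by omega))
      have hy : ∀ m, interleave p'.1 x'.1 m = z.1 (m + 2) := fun m => congrFun hy m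
      have h0 := cast_interleave_two_mul p' x' 0
      rw [hy] at h0
      simp only [mul_zero, zero_add] at h0
      have hz0 := z.2.2 0
      have hz1 := z.2.2 1
      simp only [zero_add, one_add_one_eq_two] at hz0 hz1
      obtain ⟨q, w, hq, hw, hd, he, ho⟩ := exists_entries_eq (p' := p'.1 0) (x' := x'.1 0)
        (z₁ := z.1 0) (z₂ := z.1 1) (p'.2.2 0).1
        (by rw [← h0]; exact_mod_cast hz1.1)
        (by
          rw [← h0]
          intro h
          have h : z.1 1 = z.1 2 := by exact_mod_cast h
          rw [← h]
          exact_mod_cast hz1.2 h)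
        (by exact_mod_cast hz0.1) (by exact_mod_cast hz0.2)
      obtain ⟨Lp, hLp⟩ := p'.2.1
      obtain ⟨Lx, hLx⟩ := x'.2.1
      refine ⟨(⟨fun j => Nat.casesOn j q p'.1, ⟨Lp + 1, ?_⟩, ?_⟩,
        ⟨fun j => Nat.casesOn j w x'.1, ⟨Lx + 1, ?_⟩, ?_⟩), ?_⟩
      · rintro (_ | j) hj
        · omega
        · exact hLp j (by omega)
      · rintro (_ | j)
        · exact ⟨hq, hd⟩
        · exact p'.2.2 j
      · rintro (_ | j) hj
        · omega
        · exact hLx j (by omega)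
      · rintro (_ | j)
        · exact hw
        · exact x'.2.2 j
      · funext m
        match m with
        | 0 => simp [interleaveSeq, interleave, ho]
        | 1 => simp [interleaveSeq, interleave, he]
        | m + 2 =>
          simp only [interleaveSeq]
          rw [interleave_add_two]
          exact hy m
  intro z
  obtain ⟨L, hL⟩ := z.2.1
  obtain ⟨y, hy⟩ := key L z fun m hm => hL m (by omega)
  exact ⟨y, Subtype.ext hy⟩

theorem weight_interleaveSeq (y : PrimcSeq n × PartitionSeq) :
    (interleaveSeq y).weight = y.1.weight + n * y.2.weight := by
  obtain ⟨p, x⟩ := y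
  obtain ⟨L, hL⟩ := p.2.1
  have hs : Summable fun j => (dilate (p.1 j)).toNat :=
    summable_of_eventually_zero ⟨L, fun j hj => by rw [hL j hj]; simp [dilate]⟩
  have hx : Summable x.1 := summable_of_eventually_zero x.2.1
  simp only [MultRepeatSeq.weight, PrimcSeq.weight, PartitionSeq.weight, interleaveSeq]
  rw [← hx.tsum_mul_left, ← hs.tsum_add (hx.mul_left n)]
  refine tsum_congr fun j => ?_
  rw [interleave_two_mul]
  have := dilate_nonneg (p.2.2 j).1
  have h2 : (0 : ℤ) ≤ n * x.1 j := by positivity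
  rw [oddEntry, Int.toNat_add this h2]
  congr 1

theorem bijective_interleaveSeq : Function.Bijective (interleaveSeq (n := n)) :=
  ⟨interleaveSeq_injective, interleaveSeq_surjective⟩

end Interleave

/-! ### Splitting off pairs of equal multiples of `n`. -/

/-- Finite sets of positive integers. -/
abbrev PosFinset : Type := {d : Finset ℕ // ∀ x ∈ d, 0 < x}

/-- The sum of the elements in odd position, when listed in decreasing order. -/
def PosFinset.altWeight (d : PosFinset) : ℕ := altSum (d.1.val.sort (· ≥ ·))

/-- The parts of a partition, continued by zeros. -/
def sortSeq (m : Multiset ℕ) (j : ℕ) : ℕ := (m.sort (· ≥ ·)).getD j 0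

theorem zero_notMem_sort {m : Multiset ℕ} (hm : ∀ x ∈ m, 0 < x) : 0 ∉ m.sort (· ≥ ·) := by
  intro h
  have := hm 0 ((Multiset.mem_sort _).1 h)
  omega

theorem sortSeq_step (m : Multiset ℕ) (j : ℕ) : sortSeq m (j + 1) ≤ sortSeq m j :=
  (isChain_iff_getD (R := (· ≥ ·)) (g := 0) le_rfl (fun x _ => Nat.zero_le x)).1
    (Multiset.pairwise_sort m (· ≥ ·)).isChain j

theorem sortSeq_injective {m m' : Multiset ℕ} (hm : ∀ x ∈ m, 0 < x) (hm' : ∀ x ∈ m', 0 < x)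
    (h : ∀ j, sortSeq m j = sortSeq m' j) : m = m' := by
  rw [← Multiset.sort_eq m (· ≥ ·), ← Multiset.sort_eq m' (· ≥ ·),
    list_eq_of_getD_eq (zero_notMem_sort hm) (zero_notMem_sort hm') h]

theorem exists_sortSeq_eq {x : ℕ → ℕ} (hx : ∃ L, ∀ j ≥ L, x j = 0) (hx' : ∀ j, x (j + 1) ≤ x j) :
    ∃ m : Multiset ℕ, (∀ y ∈ m, 0 < y) ∧ sortSeq m = x := by
  obtain ⟨l, hl, hl'⟩ := exists_list_of_eventually_eq hx fun j hj => by
    have := hx' j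
    omega
  have hc : l.IsChain (· ≥ ·) := by
    rw [isChain_iff_getD (R := (· ≥ ·)) (g := 0) le_rfl (fun x _ => Nat.zero_le x)]
    intro j
    rw [hl', hl']
    exact hx' j
  refine ⟨l, fun y hy => Nat.pos_of_ne_zero ?_, funext fun j => ?_⟩
  · rintro rfl
    exact hl (by simpa using hy)
  · rw [← hl' j, sortSeq]
    congr 1
    exact ((Multiset.coe_eq_coe.1 (Multiset.sort_eq (l : Multiset ℕ) (· ≥ ·))).eq_of_pairwise'
      (Multiset.pairwise_sort _ _) hc.pairwise)

/-- The parts of a multiset of positive integers in decreasing order, continued by zeros. -/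
def partitionSeqOf (m : PosMultiset) : PartitionSeq :=
  ⟨sortSeq m.1, getD_eventually_eq _, sortSeq_step m.1⟩

theorem bijective_partitionSeqOf : Function.Bijective partitionSeqOf := by
  constructor
  · intro m m' h
    exact Subtype.ext (sortSeq_injective m.2 m'.2 (congrFun (congrArg Subtype.val h)))
  · intro x
    obtain ⟨m, hm, hm'⟩ := exists_sortSeq_eq x.2.1 x.2.2
    exact ⟨⟨m, hm⟩, Subtype.ext hm'⟩

theorem weight_partitionSeqOf (m : PosMultiset) : (partitionSeqOf m).weight = m.1.sum := by
  have h := tsum_getD (g := 0) id rfl (m.1.sort (· ≥ ·))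
  simp only [id] at h
  rw [PartitionSeq.weight]
  refine h.trans ?_
  rw [List.map_id, ← Multiset.sum_coe, Multiset.sort_eq]

section MultRepeat

variable {n : ℕ}

/-- A repeated entry of `sortSeq` is an element of multiplicity at least two. -/
theorem sortSeq_repeat_iff {m : Multiset ℕ} :
    (∀ j, sortSeq m j = sortSeq m (j + 1) → n ∣ sortSeq m j) ↔ ∀ v, 2 ≤ m.count v → n ∣ v := by
  have hp := Multiset.pairwise_sort m (· ≥ ·)
  have hcount : ∀ v, (m.sort (· ≥ ·)).count v = m.count v := fun v => by
    rw [← Multiset.coe_count, Multiset.sort_eq]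
  -- Transitivity turns the condition on consecutive entries into one on all pairs, which can be
  -- tested on the sublist `[v, v]`.
  have htrans : ∀ a b c : ℕ, (b ≤ a ∧ (a = b → n ∣ a)) → (c ≤ b ∧ (b = c → n ∣ b)) →
      (c ≤ a ∧ (a = c → n ∣ a)) := by
    rintro a b c ⟨h1, h2⟩ ⟨h3, h4⟩
    exact ⟨h3.trans h1, fun h => h2 (by omega)⟩
  have hchain : (∀ j, sortSeq m j = sortSeq m (j + 1) → n ∣ sortSeq m j) ↔
      (m.sort (· ≥ ·)).IsChain (fun a b => b ≤ a ∧ (a = b → n ∣ a)) := by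
    rw [isChain_iff_getD (g := 0) ⟨le_rfl, fun _ => dvd_zero n⟩
      (fun x _ => ⟨Nat.zero_le x, fun h => h ▸ dvd_zero n⟩)]
    exact ⟨fun h j => ⟨sortSeq_step m j, h j⟩, fun h j => (h j).2⟩
  rw [hchain]
  have : Trans (fun a b : ℕ => b ≤ a ∧ (a = b → n ∣ a)) (fun a b : ℕ => b ≤ a ∧ (a = b → n ∣ a))
      (fun a b : ℕ => b ≤ a ∧ (a = b → n ∣ a)) := ⟨fun {a b c} => htrans a b c⟩
  rw [List.isChain_iff_pairwise]
  constructor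
  · intro h v hv
    rw [← hcount, ← List.replicate_sublist_iff] at hv
    have := h.sublist hv
    simp [List.replicate] at this
    exact this
  · intro h
    rw [List.pairwise_iff_forall_sublist] at hp ⊢
    intro a b hab
    refine ⟨hp hab, ?_⟩
    rintro rfl
    apply h
    rw [← hcount, ← List.replicate_sublist_iff]
    simpa [List.replicate] using hab

/-- The multiset with the elements of `d`, and `n * x` twice for each element `x` of `m`. -/
def addPairs (n : ℕ) (d : Finset ℕ) (m : Multiset ℕ) : Multiset ℕ :=
  d.val + 2 • m.map (n * ·)

theorem count_addPairs (d : Finset ℕ) (m : Multiset ℕ) (v : ℕ) :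
    (addPairs n d m).count v = (if v ∈ d then 1 else 0) + 2 * (m.map (n * ·)).count v := by
  rw [addPairs, Multiset.count_add, Multiset.count_nsmul]
  congr 1
  rw [Multiset.count_eq_of_nodup d.nodup]
  rfl

/-- The parity of each multiplicity recovers `d`, and its half recovers `m`. -/
theorem addPairs_injective (hn : 0 < n) {d d' : Finset ℕ} {m m' : Multiset ℕ}
    (h : addPairs n d m = addPairs n d' m') : d = d' ∧ m = m' := by
  have hc : ∀ v, (v ∈ d ↔ v ∈ d') ∧
      (m.map (n * ·)).count v = (m'.map (n * ·)).count v := by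
    intro v
    have hv := congrArg (Multiset.count v) h
    rw [count_addPairs, count_addPairs] at hv
    split_ifs at hv with h1 h2 h2 <;> simp only [h1, h2, true_and, iff_false, not_true] <;> omega
  refine ⟨Finset.ext fun v => (hc v).1, ?_⟩
  exact Multiset.map_injective (fun a b hab => Nat.eq_of_mul_eq_mul_left hn hab)
    (Multiset.ext.2 fun v => (hc v).2)

theorem exists_addPairs_eq {s : Multiset ℕ} (hs : ∀ v, 2 ≤ s.count v → n ∣ v)
    (hpos : ∀ v ∈ s, 0 < v) : ∃ (d : PosFinset) (m : PosMultiset), addPairs n d.1 m.1 = s := by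
  induction hk : s.card using Nat.strong_induction_on generalizing s with
  | _ k ih =>
    by_cases hd : s.Nodup
    · exact ⟨⟨⟨s, hd⟩, hpos⟩, ⟨0, by simp⟩, by simp [addPairs]⟩
    · rw [Multiset.nodup_iff_count_le_one] at hd
      push Not at hd
      obtain ⟨v, hv⟩ := hd
      -- Two copies of a repeated `v` are removed; such a `v` is a multiple of `n`, and the rest is
      -- smaller.
      obtain ⟨t, rfl⟩ := Multiset.le_iff_exists_add.1 (Multiset.le_count_iff_replicate_le.1 hv)
      obtain ⟨c, rfl⟩ := hs v hv
      obtain ⟨d, m, hdm⟩ := ih t.card (by rw [← hk]; simp) (s := t)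
        (fun w hw => hs w (by rw [Multiset.count_add]; omega))
        (fun w hw => hpos w (by simp [hw])) rfl
      have hc : 0 < c := Nat.pos_of_ne_zero fun h => by
        have := hpos (n * c) (by simp)
        simp [h] at this
      refine ⟨d, ⟨c ::ₘ m.1, fun x hx => ?_⟩, ?_⟩
      · rcases Multiset.mem_cons.1 hx with rfl | hx
        · exact hc
        · exact m.2 x hx
      · refine Eq.trans ?_ (congrArg _ hdm)
        ext w
        simp only [addPairs, Multiset.map_cons, Multiset.count_add, Multiset.count_nsmul,
          Multiset.count_cons, Multiset.count_replicate]
        split_ifs <;> omega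

theorem pos_of_mem_addPairs (hn : 0 < n) (d : PosFinset) (m : PosMultiset) :
    ∀ x ∈ addPairs n d.1 m.1, 0 < x := by
  intro x hx
  rw [addPairs, Multiset.mem_add] at hx
  rcases hx with hx | hx
  · exact d.2 x hx
  · obtain ⟨y, hy, rfl⟩ := Multiset.mem_map.1 (Multiset.mem_of_mem_nsmul hx)
    exact Nat.mul_pos hn (m.2 y hy)

/-- Adding pairs of equal multiples of `n` to a partition into distinct parts. -/
def addPairsSeq (y : PosFinset × PosMultiset) : MultRepeatSeq n :=
  ⟨sortSeq (addPairs n y.1.1 y.2.1), getD_eventually_eq _, fun j => ⟨sortSeq_step _ j,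
    sortSeq_repeat_iff.2 (fun v hv => by
      rw [count_addPairs] at hv
      have : 0 < (y.2.1.map (n * ·)).count v := by
        split_ifs at hv <;> omega
      obtain ⟨c, -, rfl⟩ := Multiset.mem_map.1 (Multiset.count_pos.1 this)
      exact dvd_mul_right n c) j⟩⟩

theorem bijective_addPairsSeq (hn : 0 < n) : Function.Bijective (addPairsSeq (n := n)) := by
  constructor
  · rintro ⟨d, m⟩ ⟨d', m'⟩ h
    have h1 := sortSeq_injective (pos_of_mem_addPairs hn d m) (pos_of_mem_addPairs hn d' m')
      (congrFun (congrArg Subtype.val h))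
    obtain ⟨h2, h3⟩ := addPairs_injective hn h1
    exact Prod.ext (Subtype.ext h2) (Subtype.ext h3)
  · intro z
    obtain ⟨s, hs, hsz⟩ := exists_sortSeq_eq z.2.1 fun j => (z.2.2 j).1
    obtain ⟨d, m, hdm⟩ := exists_addPairs_eq (sortSeq_repeat_iff.1 fun j => by
      rw [hsz]; exact (z.2.2 j).2) hs
    exact ⟨(d, m), Subtype.ext (by rw [← hsz, ← hdm]; rfl)⟩

theorem altSum_sort (B : ℕ) (s : Multiset ℕ) (hB : ∀ x ∈ s, x ≤ B) :
    altSum (s.sort (· ≥ ·)) = ∑ v ∈ Finset.range B, (s.countP (fun x => v < x) + 1) / 2 := by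
  rw [altSum_eq_sum_countP B _ (Multiset.pairwise_sort s (· ≥ ·)) fun x hx =>
    hB x ((Multiset.mem_sort _).1 hx)]
  refine Finset.sum_congr rfl fun v _ => ?_
  rw [← Multiset.coe_countP, Multiset.sort_eq]

/-- By conjugation, the weight sums the column heights halved and rounded up. A pair `n * x, n * x`
raises each of the first `n * x` heights by two, hence each rounded half by exactly one, wherever
the pair lands in the sorted order. -/
theorem weight_addPairsSeq (y : PosFinset × PosMultiset) :
    (addPairsSeq (n := n) y).weight = y.1.altWeight + n * y.2.1.sum := by
  obtain ⟨d, m⟩ := y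
  simp only [MultRepeatSeq.weight, addPairsSeq, sortSeq, PosFinset.altWeight]
  rw [tsum_getD_two_mul]
  set B := (addPairs n d.1 m.1).sum
  have hB : ∀ x ∈ addPairs n d.1 m.1, x ≤ B := fun x hx => Multiset.le_sum_of_mem hx
  have hmul : n * m.1.sum = (m.1.map (n * ·)).sum := by
    rw [Multiset.sum_map_mul_left, Multiset.map_id']
  rw [altSum_sort B _ hB, altSum_sort B _ fun x hx => hB x (Multiset.mem_add.2 (Or.inl hx)),
    hmul, ← sum_countP_lt B (m.1.map (n * ·)) fun x hx =>
    hB x (Multiset.mem_add.2 (Or.inr ((Multiset.mem_nsmul_of_ne_zero two_ne_zero).2 hx))),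
    ← Finset.sum_add_distrib]
  refine Finset.sum_congr rfl fun v _ => ?_
  rw [addPairs, Multiset.countP_add, Multiset.countP_nsmul]
  omega

end MultRepeat

/-! ### Independence of `n` and evaluation at `n = 1`. -/

section PrimcPartition

variable {n : ℕ}

/-- The sum of the dilated parts. -/
def dilatedWeight (l : PrimcPartition n) : ℕ :=
  (l.parts.map fun p : PrimcState n => (dilate p).toNat).sum

/-- Since `i ≤ n - 1`, the claim reduces to `(n - 1)(K - 1) ≥ 0`. It bounds the undilated weight and
so gives finiteness. -/
theorem le_dilate {p : PrimcState n} (hp : 0 < p.1) : (p.1 : ℤ) ≤ dilate p := by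
  have hi := p.2.1.2
  have : (1 : ℤ) ≤ p.1 := by omega
  unfold dilate
  nlinarith

theorem weight_le_dilatedWeight (l : PrimcPartition n) : l.weight ≤ dilatedWeight l := by
  refine List.sum_le_sum fun p hp => ?_
  have := le_dilate (p := p) (l.pos p hp)
  omega

theorem cast_dilatedWeight (l : PrimcPartition n) :
    (dilatedWeight l : ℤ) = (l.parts.map fun p : PrimcState n => dilate p).sum := by
  rw [dilatedWeight, Nat.cast_list_sum, List.map_map]
  refine congrArg List.sum (List.map_congr_left fun p hp => ?_)
  have := le_dilate (p := p) (l.pos p hp)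
  simp only [Function.comp]
  omega

theorem finiteWeights_dilatedWeight : FiniteWeights (dilatedWeight (n := n)) := by
  intro k
  have := fun m : Fin (k + 1) =>
    ColouredPartition.finite_weight (D := primcDiff n) m fun _ => True
  refine Finite.of_injective (β := Σ m : Fin (k + 1), {l : PrimcPartition n // l.weight = m ∧ True})
    (fun l => ⟨⟨l.1.weight, Nat.lt_succ_of_le ((weight_le_dilatedWeight l.1).trans_eq l.2)⟩,
      l.1, rfl, trivial⟩) ?_
  intro l l' h
  have h1 : ((fun x : Σ m : Fin (k + 1), {l : PrimcPartition n // l.weight = m ∧ True} => x.2.1) _)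
    = _ := congrArg (fun x => x.2.1) h
  exact Subtype.ext h1

variable [NeZero n]

/-- The ground part may follow any positive part, so continuing by zeros imposes no new condition.
-/
theorem primcDiff_zero_right_le (c : Fin n × Fin n) : primcDiff n c (0, 0) ≤ 1 := by
  rw [primcDiff, primcDelta_eq]
  have h1 := (deltaA_le_iff 1 c.1 c.2 (0 : Fin n)).2 (by omega)
  have h2 := (deltaB_le_iff 0 c.2 (0 : Fin n) (0 : Fin n)).2 (by rw [Fin.val_zero]; omega)
  simp only
  omega

/-- The parts of a generalised Primc partition, continued by parts of size zero. -/
def primcSeqOf (l : PrimcPartition n) : PrimcSeq n :=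
  ⟨fun j => l.parts.getD j (0, 0, 0), getD_eventually_eq _, fun j => by
    constructor
    · intro h
      rcases getD_mem_or_eq (g := ((0, 0, 0) : PrimcState n)) l.parts j with h1 | h1
      · exact absurd h (l.pos _ h1).ne'
      · exact h1
    · refine (isChain_iff_getD (R := fun p p' : PrimcState n =>
        primcDiff n p.2 p'.2 ≤ (p.1 : ℤ) - p'.1) ?_ fun p hp => ?_).1 l.diff j
      · simp [primcDiff, primcDelta]
      · have h1 := l.pos p hp
        have h2 := primcDiff_zero_right_le p.2
        simp only [Nat.cast_zero]
        omega⟩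

theorem ColouredPartition.ext_parts {C : Type} {D : C → C → ℤ} {l l' : ColouredPartition C D}
    (h : l.parts = l'.parts) : l = l' := by
  cases l
  cases l'
  simp only at h
  subst h
  rfl

theorem bijective_primcSeqOf : Function.Bijective (primcSeqOf (n := n)) := by
  constructor
  · intro l l' h
    refine ColouredPartition.ext_parts (list_eq_of_getD_eq (g := (0, 0, 0)) (fun h0 => ?_)
      (fun h0 => ?_) (congrFun (congrArg Subtype.val h)))
    · exact absurd (l.pos _ h0) (lt_irrefl 0)
    · exact absurd (l'.pos _ h0) (lt_irrefl 0)
  · intro p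
    obtain ⟨l, hl, hl'⟩ := exists_list_of_eventually_eq p.2.1 fun j hj => by
      have h1 := (p.2.2 j).2
      have h2 := primcDiff_nonneg (p.1 j).2 (p.1 (j + 1)).2
      refine (p.2.2 (j + 1)).1 ?_
      rw [hj] at h1 h2
      simp only [Nat.cast_zero] at h1 h2
      omega
    have hpos : ∀ q ∈ l, 0 < q.1 := by
      intro q hq
      obtain ⟨j, rfl⟩ := exists_getD_eq_of_mem (g := (0, 0, 0)) hq
      refine Nat.pos_of_ne_zero fun h0 => hl ?_
      rw [hl'] at h0 hq
      rwa [(p.2.2 j).1 h0] at hq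
    have hdiff : l.IsChain fun p p' => primcDiff n p.2 p'.2 ≤ (p.1 : ℤ) - p'.1 := by
      rw [isChain_iff_getD (g := (0, 0, 0))]
      · intro j
        rw [hl', hl']
        exact (p.2.2 j).2
      · simp [primcDiff, primcDelta]
      · intro q hq
        have h1 := hpos q hq
        have h2 := primcDiff_zero_right_le q.2
        simp only [Nat.cast_zero]
        omega
    refine ⟨⟨l, hpos, hdiff.imp fun q q' h => ?_, hdiff⟩, Subtype.ext (funext hl')⟩
    have := primcDiff_nonneg q.2 q'.2
    omega

theorem weight_primcSeqOf (l : PrimcPartition n) : (primcSeqOf l).weight = dilatedWeight l :=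
  tsum_getD (fun p : PrimcState n => (dilate p).toNat) (by simp [dilate]) l.parts

theorem finiteWeights_primcSeq : FiniteWeights (PrimcSeq.weight (n := n)) :=
  finiteWeights_dilatedWeight.of_bijective primcSeqOf bijective_primcSeqOf weight_primcSeqOf

/-- Finiteness is carried over from Primc partitions with `n = 1` through the two bijections, a set
`d` being paired with the empty multiset. -/
theorem finiteWeights_posFinset : FiniteWeights PosFinset.altWeight := by
  have h1 : FiniteWeights fun x : PrimcSeq 1 × PosMultiset => x.1.weight + 1 * x.2.1.sum :=
    finiteWeights_primcSeq.prod (finiteWeights_mul_posMultiset one_pos)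
  have h2 : FiniteWeights (MultRepeatSeq.weight (n := 1)) :=
    h1.of_bijective (fun x => interleaveSeq (x.1, partitionSeqOf x.2))
      (bijective_interleaveSeq.comp
        ((Function.bijective_id (α := PrimcSeq 1)).prodMap bijective_partitionSeqOf))
      fun x => by rw [weight_interleaveSeq, weight_partitionSeqOf]
  refine h2.of_injective (fun d => addPairsSeq (d, ⟨0, by simp⟩)) (fun d d' h => ?_) fun d => ?_
  · exact congrArg Prod.fst ((bijective_addPairsSeq one_pos).1 h)
  · simp [weight_addPairsSeq]

theorem weightGenFun_primcSeq :
    weightGenFun (PrimcSeq.weight (n := n)) = weightGenFun PosFinset.altWeight := by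
  have hn : 0 < n := Nat.pos_of_ne_zero (NeZero.ne n)
  have hM := finiteWeights_mul_posMultiset hn
  -- The common factor, counting multisets with weight `n` times their sum, is non-zero in the
  -- domain `ℤ⟦X⟧`.
  refine mul_right_cancel₀ (weightGenFun_ne_zero hM ⟨0, by simp⟩) ?_
  rw [← weightGenFun_prod finiteWeights_primcSeq hM, ← weightGenFun_prod finiteWeights_posFinset hM,
    weightGenFun_congr (W' := MultRepeatSeq.weight (n := n)) _ (bijective_addPairsSeq hn)
      weight_addPairsSeq]
  exact weightGenFun_congr (fun x => interleaveSeq (x.1, partitionSeqOf x.2))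
    (bijective_interleaveSeq.comp
      ((Function.bijective_id (α := PrimcSeq n)).prodMap bijective_partitionSeqOf))
    fun x => by rw [weight_interleaveSeq, weight_partitionSeqOf]

/-- For `n = 1` the generalised Primc partitions are the partitions. -/
theorem weightGenFun_primcSeq_one :
    weightGenFun (PrimcSeq.weight (n := 1)) = weightGenFun fun m : PosMultiset => m.1.sum := by
  rw [weightGenFun_congr (W' := PartitionSeq.weight) _ bijective_partitionSeqOf
    weight_partitionSeqOf]
  refine weightGenFun_congr (fun p => ⟨fun j => (p.1 j).1, ?_, fun j => ?_⟩) ⟨?_, ?_⟩ ?_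
  · obtain ⟨L, hL⟩ := p.2.1
    exact ⟨L, fun j hj => congrArg Prod.fst (hL j hj)⟩
  · have h1 := (p.2.2 j).2
    have h2 := primcDiff_nonneg (p.1 j).2 (p.1 (j + 1)).2
    change (p.1 (j + 1)).1 ≤ (p.1 j).1
    omega
  · intro p q h
    refine Subtype.ext (funext fun j => Prod.ext ?_ (Subsingleton.elim _ _))
    exact congrFun (congrArg Subtype.val h) j
  · intro x
    refine ⟨⟨fun j => (x.1 j, 0, 0), ?_, fun j => ⟨fun h => ?_, ?_⟩⟩, rfl⟩
    · obtain ⟨L, hL⟩ := x.2.1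
      exact ⟨L, fun j hj => Prod.ext (hL j hj) rfl⟩
    · simpa using h
    · have := x.2.2 j
      simp [primcDiff, primcDelta]
      omega
  · intro p
    refine tsum_congr fun j => ?_
    have h1 : (p.1 j).2.1 = 0 := Subsingleton.elim _ _
    have h2 : (p.1 j).2.2 = 0 := Subsingleton.elim _ _
    simp [dilate, h1, h2]

theorem weightGenFun_dilatedWeight_mul_qqInf :
    weightGenFun (dilatedWeight (n := n)) * qqInf = 1 := by
  -- The passage from `n` to `1` goes through `PosFinset.altWeight`, which involves no `n`.
  rw [weightGenFun_congr primcSeqOf bijective_primcSeqOf weight_primcSeqOf, weightGenFun_primcSeq,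
    ← weightGenFun_primcSeq (n := 1), weightGenFun_primcSeq_one, weightGenFun_posMultiset_mul_qqInf]

end PrimcPartition

/-! ### Symbol counts, colour counts and renaming of colours. -/

theorem sum_mul_countP {α C : Type} [Fintype C] [DecidableEq C] (f : C → ℤ) (h : α → C)
    (l : List α) : ∑ c, f c * (l.countP (fun a => decide (h a = c)) : ℤ)
      = (l.map fun a => f (h a)).sum := by
  induction l with
  | nil => simp
  | cons a t ih =>
    simp only [List.countP_cons, decide_eq_true_eq, Nat.cast_add, mul_add, Finset.sum_add_distrib,
      ih, List.map_cons, List.sum_cons]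
    simp [add_comm]

theorem cast_mul_weight_add_sum {C : Type} {D : C → C → ℤ} (N : ℕ) (s : C → ℤ)
    (l : ColouredPartition C D) : (N : ℤ) * l.weight + (l.parts.map fun p => s p.2).sum
      = (l.parts.map fun p => (N : ℤ) * p.1 + s p.2).sum := by
  rw [ColouredPartition.weight, Nat.cast_list_sum, List.map_map, ← List.sum_map_mul_left,
    ← List.sum_map_add]
  rfl

theorem sumsToInvQq_primcCount {n : ℕ} (hn : 0 < n) :
    SumsToInvQq (fun x : ℕ × (Fin n → ℕ) × (Fin n → ℕ) => primcCount n x.1 x.2.1 x.2.2)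
      (fun x => primcExponent n x.1 x.2.1 x.2.2) := by
  have : NeZero n := ⟨hn.ne'⟩
  refine sumsToInvQq_of_statistic finiteWeights_dilatedWeight
    (weightGenFun_dilatedWeight_mul_qqInf (n := n))
    (fun l => (l.weight, fun i => l.count fun c => c.1 = i, fun i => l.count fun c => c.2 = i))
    _ _ (fun x => ?_) fun l => ?_
  · refine Nat.card_congr (Equiv.subtypeEquivRight fun l => ?_)
    simp only [Prod.ext_iff, funext_iff, forall_and]
  -- Summing by symbols or by parts gives the same total, as each part contributes `n * K - i + k`
  -- to the exponent.
  · have hu := sum_mul_countP (fun i : Fin n => ((i : ℕ) : ℤ)) (fun p : PrimcState n => p.2.1)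
      l.parts
    have hv := sum_mul_countP (fun i : Fin n => ((i : ℕ) : ℤ)) (fun p : PrimcState n => p.2.2)
      l.parts
    have hs := cast_mul_weight_add_sum n (fun c => ((c.2 : ℕ) : ℤ) - (c.1 : ℕ)) l
    have hsub := List.sum_map_add (l := l.parts) (f := fun p => ((p.2.2 : ℕ) : ℤ) - (p.2.1 : ℕ))
      (g := fun p => ((p.2.1 : ℕ) : ℤ))
    simp only [sub_add_cancel] at hsub
    rw [cast_dilatedWeight, primcExponent]
    simp only [mul_sub, Finset.sum_sub_distrib, ColouredPartition.count]
    rw [hu, hv]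
    have he : (l.parts.map fun p : PrimcState n => dilate p)
        = l.parts.map fun p => (n : ℤ) * p.1 + (((p.2.2 : ℕ) : ℤ) - (p.2.1 : ℕ)) :=
      List.map_congr_left fun p _ => by unfold dilate; ring
    rw [he, ← hs]
    linear_combination hsub

/-- Renaming the colours. -/
def ColouredPartition.recolour {C C' : Type} {D : C → C → ℤ} {D' : C' → C' → ℤ} (e : C → C')
    (hD : ∀ x y, D x y = D' (e x) (e y)) (l : ColouredPartition C D) : ColouredPartition C' D' where
  parts := l.parts.map (Prod.map id e)
  pos := by
    intro p hp
    obtain ⟨q, hq, rfl⟩ := List.mem_map.1 hp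
    exact l.pos q hq
  noninc := by
    rw [List.isChain_map]
    exact l.noninc
  diff := by
    rw [List.isChain_map]
    exact l.diff.imp fun p p' h => by simpa [hD] using h

theorem ColouredPartition.bijective_recolour {C C' : Type} {D : C → C → ℤ} {D' : C' → C' → ℤ}
    {e : C → C'} (he : Function.Bijective e) (hD : ∀ x y, D x y = D' (e x) (e y)) :
    Function.Bijective (recolour e hD) := by
  constructor
  · intro l l' h
    exact ext_parts (List.map_injective_iff.2 (Function.injective_id.prodMap he.1)
      (congrArg parts h))
  · intro l
    let f := (Equiv.ofBijective e he).symm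
    have hf : ∀ c, e (f c) = c := (Equiv.ofBijective e he).apply_symm_apply
    refine ⟨l.recolour f fun x y => by rw [hD, hf, hf], ext_parts ?_⟩
    simp only [recolour, List.map_map]
    conv_rhs => rw [← List.map_id l.parts]
    exact List.map_congr_left fun p _ => Prod.ext rfl (hf p.2)

/-- The dilated weight is pulled back along the renaming `e`; the shift `k - i` of a colour makes it
a function of the weight and the colour counts. -/
theorem sumsToInvQq_colourCount {n r : ℕ} (hn : 0 < n) {D : Fin r → Fin r → ℤ} {s : Fin r → ℤ}
    {e : Fin r → Fin n × Fin n} (he : Function.Bijective e)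
    (hD : ∀ x y, D x y = primcDiff n (e x) (e y))
    (hs : ∀ x, s x = ((e x).2 : ℤ) - ((e x).1 : ℤ)) :
    SumsToInvQq (fun x : ℕ × (Fin r → ℕ) => colourCount D x.1 x.2)
      (fun x => dilatedExponent n s x.1 x.2) := by
  have : NeZero n := ⟨hn.ne'⟩
  have hbij := ColouredPartition.bijective_recolour he hD
  have hfin : FiniteWeights fun l => dilatedWeight (ColouredPartition.recolour e hD l) :=
    finiteWeights_dilatedWeight.of_injective _ hbij.1 fun _ => rfl
  refine sumsToInvQq_of_statistic hfin ?_
    (fun l => (l.weight, fun c => l.count fun c' => c' = c)) _ _ (fun x => ?_) fun l => ?_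
  · rw [weightGenFun_congr (W' := dilatedWeight (n := n)) _ hbij fun _ => rfl]
    exact weightGenFun_dilatedWeight_mul_qqInf
  · refine Nat.card_congr (Equiv.subtypeEquivRight fun l => ?_)
    simp only [Prod.ext_iff, funext_iff]
  · rw [cast_dilatedWeight, dilatedExponent]
    simp only [ColouredPartition.count]
    rw [sum_mul_countP s (fun p : ℕ × Fin r => p.2) l.parts, cast_mul_weight_add_sum]
    simp only [ColouredPartition.recolour, List.map_map]
    refine congrArg List.sum (List.map_congr_left fun p _ => ?_)
    simp only [Function.comp, dilate, hs, Prod.map, id]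
    ring

theorem mainTheorem6 :
    -- the principal specialisation, for every positive integer `n`
    (∀ n : ℕ, 0 < n →
      SumsToInvQq (fun x : ℕ × (Fin n → ℕ) × (Fin n → ℕ) => primcCount n x.1 x.2.1 x.2.2)
        (fun x => primcExponent n x.1 x.2.1 x.2.2)) ∧
    -- `n = 2` is Primc's identity with four colours
    (Function.Bijective primcColour4 ∧
      (∀ x y, primcMatrix4 x y = primcDiff 2 (primcColour4 x) (primcColour4 y)) ∧
      (∀ x, primcShift4 x = ((primcColour4 x).2 : ℤ) - ((primcColour4 x).1 : ℤ)) ∧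
      SumsToInvQq (fun x : ℕ × (Fin 4 → ℕ) => colourCount primcMatrix4 x.1 x.2)
        (fun x => dilatedExponent 2 primcShift4 x.1 x.2)) ∧
    -- `n = 3` is Primc's identity with nine colours
    (Function.Bijective primcColour9 ∧
      (∀ x y, primcMatrix9 x y = primcDiff 3 (primcColour9 x) (primcColour9 y)) ∧
      (∀ x, primcShift9 x = ((primcColour9 x).2 : ℤ) - ((primcColour9 x).1 : ℤ)) ∧
      SumsToInvQq (fun x : ℕ × (Fin 9 → ℕ) => colourCount primcMatrix9 x.1 x.2)
        (fun x => dilatedExponent 3 primcShift9 x.1 x.2)) := by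
  have b4 : Function.Bijective primcColour4 := by
    unfold Function.Bijective Function.Injective Function.Surjective
    decide
  have d4 : ∀ x y, primcMatrix4 x y = primcDiff 2 (primcColour4 x) (primcColour4 y) := by decide
  have s4 : ∀ x, primcShift4 x = ((primcColour4 x).2 : ℤ) - ((primcColour4 x).1 : ℤ) := by decide
  have b9 : Function.Bijective primcColour9 := by
    unfold Function.Bijective Function.Injective Function.Surjective
    decide
  have d9 : ∀ x y, primcMatrix9 x y = primcDiff 3 (primcColour9 x) (primcColour9 y) := by decide
  have s9 : ∀ x, primcShift9 x = ((primcColour9 x).2 : ℤ) - ((primcColour9 x).1 : ℤ) := by decide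
  exact ⟨fun n hn => sumsToInvQq_primcCount hn,
    ⟨b4, d4, s4, sumsToInvQq_colourCount two_pos b4 d4 s4⟩,
    ⟨b9, d9, s9, sumsToInvQq_colourCount three_pos b9 d9 s9⟩⟩
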